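/- Let $\mathcal G=(\mathcal V,\mathcal E)$ be a weakly connected oriented graph (finite, with $(i,j)\in\mathcal E$ only if $i<j$, at least two nodes), with incidence matrix $A\in\{0,\pm1\}^{\mathcal E\times\mathcal V}$ whose row $e=(i,j)$ has $+1$ in column $i$, $-1$ in column $j$ and $0$ elsewhere, and let $L=A^\top A$. Let $b\in\mathbb R^{\mathcal E}$ and $\gamma\in(0,1)$, and let $\theta(0),\theta(1),\dots$ be independent random edges, each uniformly distributed on $\mathcal E$. Consider the random process $(x(k),\kappa(k),\widetilde x(k))\in\mathbb R^{\mathcal V}\times\mathbb Z_{\ge0}^{\mathcal V}\times\mathbb R^{\mathcal V}$ with $x(0)=0$, $\kappa(0)=0$, $\widetilde x(0)=0$ and, for $k\ge0$, if $\theta(k)=(i,j)$, $$x_i(k+1)=(1-\gamma)x_i(k)+\gamma x_j(k)+\gamma b_{(i,j)},\qquad x_j(k+1)=(1-\gamma)x_j(k)+\gamma x_i(k)-\gamma b_{(i,j)},$$ $$\kappa_\ell(k+1)=\kappa_\ell(k)+1,\qquad \widetilde x_\ell(k+1)=\frac{1}{\kappa_\ell(k+1)}\bigl(\kappa_\ell(k)\,\widetilde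 x_\ell(k)+x_\ell(k+1)\bigr)\qquad(\ell\in\{i,j\}),$$ while $x_\ell,\kappa_\ell,\widetilde x_\ell$ are unchanged for $\ell\notin\{i,j\}$. Then, with $L^\dagger$ the Moore--Penrose pseudoinverse of $L$, the vector $L^\dagger A^\top b$ is the unique element of minimum Euclidean norm among the minimizers of $z\mapsto\|Az-b\|_2^2$ over $\mathbb R^{\mathcal V}$, and $$\lim_{k\to\infty}\widetilde x(k)=L^\dagger A^\top b\qquad\text{almost surely.}$$ -/

import Mathlib

open Matrix MeasureTheory ProbabilityTheory Filter Topology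

/-- `X` is a Moore–Penrose pseudoinverse of the real matrix `M`: the four Penrose equations. -/
structure IsMoorePenrose {m n : Type*} [Fintype m] [Fintype n]
    (M : Matrix m n ℝ) (X : Matrix n m ℝ) : Prop where
  mul_mul_left : M * X * M = M
  mul_mul_right : X * M * X = X
  symm_left : (M * X)ᵀ = M * X
  symm_right : (X * M)ᵀ = X * M

theorem IsMoorePenrose.unique {m n : Type*} [Fintype m] [Fintype n]
    {M : Matrix m n ℝ} {X Y : Matrix n m ℝ}
    (hX : IsMoorePenrose M X) (hY : IsMoorePenrose M Y) : X = Y := by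
  have h1 : M * X = M * Y := by
    calc M * X = (M * Y * M) * X := by rw [hY.mul_mul_left]
      _ = (M * Y) * (M * X) := by simp only [Matrix.mul_assoc]
      _ = ((M * X) * (M * Y))ᵀ := by rw [Matrix.transpose_mul, hX.symm_left, hY.symm_left]
      _ = ((M * X * M) * Y)ᵀ := by simp only [Matrix.mul_assoc]
      _ = M * Y := by rw [hX.mul_mul_left, hY.symm_left]
  have h2 : X * M = Y * M := by
    calc X * M = X * (M * Y * M) := by rw [hY.mul_mul_left]
      _ = (X * M) * (Y * M) := by simp only [Matrix.mul_assoc]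
      _ = ((Y * M) * (X * M))ᵀ := by rw [Matrix.transpose_mul, hX.symm_right, hY.symm_right]
      _ = (Y * (M * X * M))ᵀ := by simp only [Matrix.mul_assoc]
      _ = Y * M := by rw [hX.mul_mul_left, hY.symm_right]
  calc X = X * M * X := hX.mul_mul_right.symm
    _ = Y * (M * X) := by rw [h2, Matrix.mul_assoc]
    _ = Y * M * Y := by rw [h1, Matrix.mul_assoc]
    _ = Y := hY.mul_mul_right

theorem exists_isMoorePenrose_of_isHermitian {n : Type*} [Fintype n]
    (S : Matrix n n ℝ) (hS : S.IsHermitian) :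
    ∃ X : Matrix n n ℝ, Xᵀ = X ∧ IsMoorePenrose S X := by
  classical
  have hc : ∀ f : ℝ → ℝ, ContinuousOn f (spectrum ℝ S) := fun f =>
    (Matrix.finite_real_spectrum (A := S)).continuousOn f
  have hsa : IsSelfAdjoint S := hS
  set X : Matrix n n ℝ := cfc (fun x : ℝ => x⁻¹) S with hXdef
  have hid : cfc (fun x : ℝ => x) S = S := cfc_id' ℝ S
  have hX : Xᵀ = X := by
    have h : IsSelfAdjoint X := cfc_predicate (fun x : ℝ => x⁻¹) S
    simpa [IsSelfAdjoint, Matrix.star_eq_conjTranspose] using h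
  have hSt : Sᵀ = S := by simpa using hS.eq
  have h1 : S * X = cfc (fun x : ℝ => x * x⁻¹) S := by
    rw [cfc_mul (fun x : ℝ => x) (fun x : ℝ => x⁻¹) S (hc _) (hc _), hid]
  have h2 : X * S = cfc (fun x : ℝ => x⁻¹ * x) S := by
    rw [cfc_mul (fun x : ℝ => x⁻¹) (fun x : ℝ => x) S (hc _) (hc _), hid]
  have h12 : S * X = X * S := by
    rw [h1, h2]; congr 1; funext x; exact mul_comm _ _
  refine ⟨X, hX, ?_, ?_, ?_, ?_⟩
  · have : S * X * S = cfc (fun x : ℝ => x * x⁻¹ * x) S := by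
      rw [cfc_mul (fun x : ℝ => x * x⁻¹) (fun x : ℝ => x) S (hc _) (hc _), hid, h1]
    rw [this]; simpa using hid
  · have : X * S * X = cfc (fun x : ℝ => x⁻¹ * x * x⁻¹) S := by
      rw [cfc_mul (fun x : ℝ => x⁻¹ * x) (fun x : ℝ => x⁻¹) S (hc _) (hc _), h2]
    rw [this, hXdef]; congr 1; funext x
    by_cases hx : x = 0
    · simp [hx]
    · rw [inv_mul_cancel₀ hx, one_mul]
  · rw [Matrix.transpose_mul, hX, hSt, h12]
  · rw [Matrix.transpose_mul, hX, hSt, h12]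

theorem exists_isMoorePenrose {m n : Type*} [Fintype m] [Fintype n]
    (M : Matrix m n ℝ) : ∃ X : Matrix n m ℝ, IsMoorePenrose M X := by
  classical
  obtain ⟨Y, hYt, hY⟩ := exists_isMoorePenrose_of_isHermitian (Mᵀ * M)
    (by simpa using Matrix.isHermitian_conjTranspose_mul_self M)
  have h0 : M * (Y * (Mᵀ * M) - 1) = 0 := by
    have : (M * (Y * (Mᵀ * M) - 1))ᴴ * (M * (Y * (Mᵀ * M) - 1)) = 0 := by
      have e : Mᵀ * (M * (Y * (Mᵀ * M) - 1)) = 0 := by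
        rw [← Matrix.mul_assoc, Matrix.mul_sub, ← Matrix.mul_assoc, hY.mul_mul_left]
        simp
      rw [Matrix.conjTranspose_mul, Matrix.mul_assoc, Matrix.conjTranspose_eq_transpose_of_trivial M,
        e, Matrix.mul_zero]
    exact Matrix.conjTranspose_mul_self_eq_zero.mp this
  refine ⟨Y * Mᵀ, ?_, ?_, ?_, ?_⟩
  · rw [Matrix.mul_sub, sub_eq_zero, Matrix.mul_one] at h0
    rw [Matrix.mul_assoc, Matrix.mul_assoc, h0]
  · have := hY.mul_mul_right
    calc Y * Mᵀ * M * (Y * Mᵀ) = (Y * (Mᵀ * M) * Y) * Mᵀ := by simp only [Matrix.mul_assoc]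
      _ = Y * Mᵀ := by rw [this]
  · simp [Matrix.transpose_mul, hYt, Matrix.mul_assoc]
  · rw [Matrix.mul_assoc, hY.symm_right]

/-- The Moore–Penrose pseudoinverse of a real matrix. -/
noncomputable def pinv {m n : Type*} [Fintype m] [Fintype n]
    (M : Matrix m n ℝ) : Matrix n m ℝ :=
  Classical.choose (exists_isMoorePenrose M)

theorem pinv_spec {m n : Type*} [Fintype m] [Fintype n]
    (M : Matrix m n ℝ) : IsMoorePenrose M (pinv M) :=
  Classical.choose_spec (exists_isMoorePenrose M)

/-- An oriented graph on the ordered vertex set `V`: a set of edges `(i, j)` with `i < j`. -/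
structure OrientedGraph (V : Type*) [LinearOrder V] where
  edges : Finset (V × V)
  lt_of_mem : ∀ e ∈ edges, e.1 < e.2

namespace OrientedGraph

/-- The type of edges of an oriented graph. -/
def Edge {V : Type*} [LinearOrder V] (G : OrientedGraph V) : Type _ :=
  {e : V × V // e ∈ G.edges}

instance {V : Type*} [LinearOrder V] (G : OrientedGraph V) : Fintype G.Edge :=
  inferInstanceAs (Fintype {e : V × V // e ∈ G.edges})

/-- Every set of edges is measurable. -/
instance {V : Type*} [LinearOrder V] (G : OrientedGraph V) : MeasurableSpace G.Edge := ⊤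

/-- First endpoint `i` of the edge `(i, j)`. -/
def Edge.src {V : Type*} [LinearOrder V] {G : OrientedGraph V} (e : G.Edge) : V := e.1.1

/-- Second endpoint `j` of the edge `(i, j)`. -/
def Edge.tgt {V : Type*} [LinearOrder V] {G : OrientedGraph V} (e : G.Edge) : V := e.1.2

/-- Weak connectedness: any two nodes are joined by a path that may traverse each edge in
either direction. -/
def WeaklyConnected {V : Type*} [LinearOrder V] (G : OrientedGraph V) : Prop :=
  (SimpleGraph.fromRel (fun i j : V => (i, j) ∈ G.edges)).Connected

/-- The incidence matrix: the row of `e = (i, j)` is `+1` at `i`, `-1` at `j`, `0` elsewhere. -/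
def incidence {V : Type*} [LinearOrder V] (G : OrientedGraph V) : Matrix G.Edge V ℝ :=
  Matrix.of fun e v => if v = e.src then 1 else if v = e.tgt then -1 else 0

/-- The Laplacian `L = Aᵀ A`. -/
def laplacian {V : Type*} [LinearOrder V] (G : OrientedGraph V) : Matrix V V ℝ :=
  G.incidenceᵀ * G.incidence

/-- `z` minimizes `‖A z - b‖₂²` over `ℝ^V`. -/
def IsLeastSquares {V : Type*} [LinearOrder V] [Fintype V] (G : OrientedGraph V)
    (b : G.Edge → ℝ) (z : V → ℝ) : Prop :=
  ∀ w : V → ℝ, ‖WithLp.toLp 2 (G.incidence *ᵥ z - b)‖ ^ 2 ≤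
    ‖WithLp.toLp 2 (G.incidence *ᵥ w - b)‖ ^ 2

/-- `z` is a least-squares solution of minimum Euclidean norm. -/
def IsMinNormLeastSquares {V : Type*} [LinearOrder V] [Fintype V] (G : OrientedGraph V)
    (b : G.Edge → ℝ) (z : V → ℝ) : Prop :=
  G.IsLeastSquares b z ∧
    ∀ w : V → ℝ, G.IsLeastSquares b w → ‖WithLp.toLp 2 z‖ ≤ ‖WithLp.toLp 2 w‖

/-- The vector `L† Aᵀ b`. -/
noncomputable def optimalEstimate {V : Type*} [LinearOrder V] [Fintype V] (G : OrientedGraph V)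
    (b : G.Edge → ℝ) : V → ℝ :=
  pinv G.laplacian *ᵥ (G.incidenceᵀ *ᵥ b)

end OrientedGraph

/-- The state of the gossip algorithm: for every node the raw estimate, the local clock (number of
updates performed) and the time-average of the raw estimate along the local clock. -/
structure GossipState (V : Type*) where
  raw : V → ℝ
  clock : V → ℕ
  avg : V → ℝ

/-- The update of the raw estimates when the edge `e = (i, j)` is selected. -/
def gossipRaw {V : Type*} [LinearOrder V] {G : OrientedGraph V} (γ : ℝ) (b : G.Edge → ℝ)
    (e : G.Edge) (x : V → ℝ) : V → ℝ := fun l =>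
  if l = e.src then (1 - γ) * x e.src + γ * x e.tgt + γ * b e
  else if l = e.tgt then (1 - γ) * x e.tgt + γ * x e.src - γ * b e
  else x l

/-- The update of the local clocks when the edge `e = (i, j)` is selected. -/
def gossipClock {V : Type*} [LinearOrder V] {G : OrientedGraph V}
    (e : G.Edge) (κ : V → ℕ) : V → ℕ := fun l =>
  if l = e.src ∨ l = e.tgt then κ l + 1 else κ l

/-- One step of the gossip algorithm when the edge `e = (i, j)` is selected. The time-averages of
`i` and `j` are updated with the new raw estimates and the new local clocks. -/
noncomputable def gossipStep {V : Type*} [LinearOrder V] {G : OrientedGraph V} (γ : ℝ)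
    (b : G.Edge → ℝ) (e : G.Edge) (s : GossipState V) : GossipState V where
  raw := gossipRaw γ b e s.raw
  clock := gossipClock e s.clock
  avg := fun l =>
    if l = e.src ∨ l = e.tgt then
      1 / (gossipClock e s.clock l : ℝ) * ((s.clock l : ℝ) * s.avg l + gossipRaw γ b e s.raw l)
    else s.avg l

/-- The state at time `k` of the gossip algorithm started at zero, along the sequence `θ` of
selected edges. -/
noncomputable def gossip {V : Type*} [LinearOrder V] {G : OrientedGraph V} (γ : ℝ)
    (b : G.Edge → ℝ) (θ : ℕ → G.Edge) : ℕ → GossipState V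
  | 0 => ⟨fun _ => 0, fun _ => 0, fun _ => 0⟩
  | k + 1 => gossipStep γ b (θ k) (gossip γ b θ k)

/-! Write y(k) for the deviation of x(k) from x* = L†Aᵀb, r = b - Ax* for the residual, and m for
the number of edges. The normal equations give Aᵀr = 0, so the mean of a step given the past is
linear in the deviation: -(γ/m) L y(k). In general x(k) does not converge, because r keeps
perturbing it, but its energy stays bounded in mean: y(k) has zero sum, so the Poincaré inequality
turns the mean dissipation (2γ(1-γ)/m)‖Ay‖² into a contraction up to an additive constant
(`exists_mean_energy_le`, `exists_integral_energy_le`).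

With bounded second moments, h(θ(s), y(s)) minus its mean over the draw is a sequence of orthogonal
martingale differences and obeys a strong law (`ae_tendsto_average_sub_mean`). The law is used three
times at each node l. For the increments of y, the sum telescopes to y(n) - y(0) = o(n), so L maps
the time-average of y to a null sequence; L is invertible on zero-sum vectors, so that average
itself tends to 0. For the activation indicator (the square of the incidence entry), the clock
divided by n tends to deg(l)/m > 0. For the indicator times the updated error, the sum of errors
over activation times is o(n) plus a combination of sums already known to be o(n). The quotient of
the last two limits is the claim (`tendsto_avg_of_averages`).

The least-squares half is Pythagoras twice: r is orthogonal to the range of A, and x* to its kernel.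
-/

/-! ### Functionals of finitely many draws. -/

section PathFunctions

/-- A function of the first `k` terms of a sequence factors through their tuple. -/
theorem DependsOn.exists_factor {E β : Type*} [Nonempty E] {k : ℕ} {f : (ℕ → E) → β}
    (hf : DependsOn f (Set.Iio k)) :
    ∃ g : (Finset.range k → E) → β, ∀ p : ℕ → E, f p = g fun i => p i := by
  refine ⟨fun q => f fun i => if h : i ∈ Finset.range k then q ⟨i, h⟩ else Classical.arbitrary E,
    fun p => hf fun i hi => ?_⟩
  have : i < k := hi
  simp [this]

variable {E Ω : Type*} [Fintype E] [MeasurableSpace E] [MeasurableSingletonClass E]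
  [MeasurableSpace Ω] {μ : Measure Ω} [IsProbabilityMeasure μ] {θ : ℕ → Ω → E}

theorem DependsOn.integrable_path [Nonempty E] {k : ℕ} {f : (ℕ → E) → ℝ}
    (hf : DependsOn f (Set.Iio k)) (hθ : ∀ k, Measurable (θ k)) :
    Integrable (fun ω => f fun l => θ l ω) μ := by
  obtain ⟨g, hg⟩ := hf.exists_factor
  have hX : Measurable fun ω (i : Finset.range k) => θ i ω := measurable_pi_lambda _ fun i => hθ i
  have : IsFiniteMeasure (μ.map fun ω (i : Finset.range k) => θ i ω) :=
    Measure.isFiniteMeasure_map _ _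
  have hi : Integrable g (μ.map fun ω (i : Finset.range k) => θ i ω) := Integrable.of_finite
  simpa only [hg] using! hi.comp_measurable hX

/-- Averaging over a uniform draw that is independent of the past. -/
theorem integral_uniform_step [Nonempty E] (hθ : ∀ k, Measurable (θ k)) (hind : iIndepFun θ μ)
    (hunif : ∀ (k : ℕ) (e : E), μ.real {ω | θ k ω = e} = 1 / (Fintype.card E : ℝ))
    {k : ℕ} {F : E → (ℕ → E) → ℝ} (hF : ∀ e, DependsOn (F e) (Set.Iio k)) :
    ∫ ω, F (θ k ω) (fun l => θ l ω) ∂μ =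
      ∫ ω, (∑ e, F e fun l => θ l ω) / (Fintype.card E : ℝ) ∂μ := by
  classical
  have hdec : ∀ ω, F (θ k ω) (fun l => θ l ω) =
      ∑ e, (if θ k ω = e then 1 else 0) * F e (fun l => θ l ω) := by
    intro ω
    simp
  have hmeasI : ∀ e, MeasurableSet {ω | θ k ω = e} := fun e => hθ k (measurableSet_singleton e)
  have hindI : ∀ e, (fun ω => if θ k ω = e then (1 : ℝ) else 0) =
      Set.indicator {ω | θ k ω = e} fun _ => 1 := by
    intro e
    ext ω
    simp [Set.indicator]
  have hIint : ∀ e, Integrable (fun ω => if θ k ω = e then (1 : ℝ) else 0) μ := by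
    intro e
    rw [hindI]
    exact (integrable_const _).indicator (hmeasI e)
  have hIval : ∀ e, ∫ ω, (if θ k ω = e then (1 : ℝ) else 0) ∂μ = 1 / (Fintype.card E : ℝ) := by
    intro e
    rw [hindI, integral_indicator_const _ (hmeasI e), hunif]
    simp
  have hindep : ∀ e, IndepFun (fun ω => if θ k ω = e then (1 : ℝ) else 0)
      (fun ω => F e fun l => θ l ω) μ := by
    intro e
    obtain ⟨g, hg⟩ := (hF e).exists_factor
    -- Draw k is independent of the tuple of earlier draws, through which `F e` factors.
    have h := hind.indepFun_finset {k} (Finset.range k) (by simp) hθ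
    have := h.comp (φ := fun q : (({k} : Finset ℕ) → E) =>
        if q ⟨k, by simp⟩ = e then (1 : ℝ) else 0) (ψ := g)
      (measurable_of_finite _) (measurable_of_finite _)
    simpa only [hg] using! this
  have hFint : ∀ e, Integrable (fun ω => F e fun l => θ l ω) μ :=
    fun e => (hF e).integrable_path hθ
  have hprod : ∀ e, Integrable (fun ω => (if θ k ω = e then (1 : ℝ) else 0) *
      F e fun l => θ l ω) μ := fun e => (hindep e).integrable_mul (hIint e) (hFint e)
  simp_rw [hdec]
  rw [integral_finsetSum _ fun e _ => hprod e,
    integral_div, integral_finsetSum _ fun e _ => hFint e, Finset.sum_div]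
  refine Finset.sum_congr rfl fun e _ => ?_
  rw [(hindep e).integral_fun_mul_eq_mul_integral (hIint e).aestronglyMeasurable
    (hFint e).aestronglyMeasurable, hIval]
  ring

end PathFunctions

/-! ### Almost sure limits from second moments. -/

section SecondMoments

variable {Ω : Type*} [MeasurableSpace Ω] {μ : Measure Ω}

/-- By Tonelli the sum of the squares has finite integral, so it converges almost everywhere and its
terms vanish. -/
theorem ae_tendsto_zero_of_summable_integral_sq {Z : ℕ → Ω → ℝ}
    (hZ : ∀ n, Integrable (fun ω => Z n ω ^ 2) μ)
    (hs : Summable fun n => ∫ ω, Z n ω ^ 2 ∂μ) :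
    ∀ᵐ ω ∂μ, Tendsto (fun n => Z n ω) atTop (𝓝 0) := by
  have hfin : ∫⁻ ω, ∑' n, ENNReal.ofReal (Z n ω ^ 2) ∂μ ≠ ⊤ := by
    rw [lintegral_tsum fun n => (hZ n).aestronglyMeasurable.aemeasurable.ennreal_ofReal]
    simp_rw [← fun n => ofReal_integral_eq_lintegral_ofReal (hZ n)
      (Eventually.of_forall fun ω => sq_nonneg (Z n ω))]
    exact hs.tsum_ofReal_ne_top
  have hae := ae_lt_top' (AEMeasurable.tsum fun n =>
    (hZ n).aestronglyMeasurable.aemeasurable.ennreal_ofReal) hfin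
  filter_upwards [hae] with ω hω
  have h0 := ENNReal.tendsto_atTop_zero_of_tsum_ne_top hω.ne
  have h1 : Tendsto (fun n => Z n ω ^ 2) atTop (𝓝 0) := by
    have := (ENNReal.tendsto_toReal ENNReal.zero_ne_top).comp h0
    simpa [Function.comp_def, ENNReal.toReal_ofReal (sq_nonneg _)] using this
  have h2 := h1.sqrt
  simp only [Real.sqrt_sq_eq_abs, Real.sqrt_zero] at h2
  exact (tendsto_zero_iff_abs_tendsto_zero _).2 h2

theorem ae_tendsto_div_sq_of_integral_sq_le {Z : ℕ → Ω → ℝ} {C : ℝ}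
    (hZ : ∀ n, Integrable (fun ω => Z n ω ^ 2) μ)
    (hC : ∀ n : ℕ, ∫ ω, Z n ω ^ 2 ∂μ ≤ C * (n : ℝ) ^ 2) :
    ∀ᵐ ω ∂μ, Tendsto (fun n : ℕ => Z n ω / (n : ℝ) ^ 2) atTop (𝓝 0) := by
  have hdiv : ∀ n : ℕ, ∀ ω, (Z n ω / (n : ℝ) ^ 2) ^ 2 = Z n ω ^ 2 / (n : ℝ) ^ 4 := by
    intro n ω
    rw [div_pow]
    ring
  refine ae_tendsto_zero_of_summable_integral_sq (fun n => ?_) ?_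
  · simp_rw [hdiv]
    exact (hZ n).div_const _
  · simp_rw [hdiv, integral_div]
    refine Summable.of_nonneg_of_le (fun n => div_nonneg (integral_nonneg fun ω => sq_nonneg _)
      (by positivity)) (fun n => ?_)
      (((Real.summable_one_div_nat_pow (p := 2)).2 (by norm_num)).mul_left C)
    rcases eq_or_ne n 0 with rfl | hn
    · simp
    have : (n : ℝ) ≠ 0 := by exact_mod_cast hn
    calc (∫ ω, Z n ω ^ 2 ∂μ) / (n : ℝ) ^ 4 ≤ C * (n : ℝ) ^ 2 / (n : ℝ) ^ 4 := by
          gcongr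
          exact hC n
      _ = C * (1 / (n : ℝ) ^ 2) := by field_simp

theorem ae_tendsto_div_of_integral_sq_le {Z : ℕ → Ω → ℝ} {C : ℝ}
    (hZ : ∀ n, Integrable (fun ω => Z n ω ^ 2) μ)
    (hC : ∀ n : ℕ, ∫ ω, Z n ω ^ 2 ∂μ ≤ C) :
    ∀ᵐ ω ∂μ, Tendsto (fun n : ℕ => Z n ω / (n : ℝ)) atTop (𝓝 0) := by
  have h := ae_tendsto_div_sq_of_integral_sq_le (μ := μ) (Z := fun n ω => n * Z n ω) (C := C)
    (fun n => by simpa only [mul_pow] using (hZ n).const_mul _) (fun n => by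
      simp only [mul_pow, integral_const_mul]
      nlinarith [hC n, sq_nonneg (n : ℝ)])
  filter_upwards [h] with ω hω
  refine hω.congr fun n => ?_
  rcases eq_or_ne n 0 with rfl | hn
  · simp
  have : (n : ℝ) ≠ 0 := by exact_mod_cast hn
  field_simp

/-- A strong law of large numbers from second moment bounds on the terms and on the partial
sums. -/
theorem ae_tendsto_sum_div_of_integral_sq_le {z : ℕ → Ω → ℝ} {C : ℝ}
    (hz : ∀ n, Integrable (fun ω => z n ω ^ 2) μ)
    (hzm : ∀ n, AEStronglyMeasurable (z n) μ)
    (hS : ∀ n, Integrable (fun ω => (∑ s ∈ Finset.range n, z s ω) ^ 2) μ)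
    (hzC : ∀ n, ∫ ω, z n ω ^ 2 ∂μ ≤ C)
    (hSC : ∀ n : ℕ, ∫ ω, (∑ s ∈ Finset.range n, z s ω) ^ 2 ∂μ ≤ C * n) :
    ∀ᵐ ω ∂μ, Tendsto (fun n : ℕ => (∑ s ∈ Finset.range n, z s ω) / (n : ℝ)) atTop (𝓝 0) := by
  have hC0 : 0 ≤ C := (integral_nonneg fun ω => sq_nonneg _).trans (hzC 0)
  -- `R k` dominates the fluctuation of the partial sums between k² and (k+1)². The partial sums are
  -- controlled along squares, where the second moments of the quotients are summable; the blocks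
  -- fill the gaps.
  set R : ℕ → Ω → ℝ := fun k ω => ∑ s ∈ Finset.Ico (k ^ 2) ((k + 1) ^ 2), |z s ω| with hR
  have hRle : ∀ k ω, R k ω ^ 2 ≤
      (2 * k + 1) * ∑ s ∈ Finset.Ico (k ^ 2) ((k + 1) ^ 2), z s ω ^ 2 := by
    intro k ω
    have h := sq_sum_le_card_mul_sum_sq (s := Finset.Ico (k ^ 2) ((k + 1) ^ 2))
      (f := fun s => |z s ω|)
    have hc : ((k + 1) ^ 2 - k ^ 2 : ℕ) = 2 * k + 1 := by
      have : (k + 1) ^ 2 = k ^ 2 + (2 * k + 1) := by ring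
      omega
    simpa [hc, sq_abs] using h
  have hBint : ∀ k : ℕ, Integrable (fun ω =>
      (2 * k + 1 : ℝ) * ∑ s ∈ Finset.Ico (k ^ 2) ((k + 1) ^ 2), z s ω ^ 2) μ := fun k =>
    (integrable_finsetSum _ fun s _ => hz s).const_mul _
  have hRint : ∀ k, Integrable (fun ω => R k ω ^ 2) μ := by
    intro k
    refine (hBint k).mono' ?_ (Eventually.of_forall fun ω => ?_)
    · exact (Finset.aestronglyMeasurable_fun_sum _ fun s _ => (hzm s).norm).pow 2
    · rw [Real.norm_of_nonneg (sq_nonneg _)]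
      exact hRle k ω
  have hA := ae_tendsto_div_sq_of_integral_sq_le (μ := μ)
    (Z := fun k ω => ∑ s ∈ Finset.range (k ^ 2), z s ω) (C := C) (fun k => hS _)
    (fun k => by
      have := hSC (k ^ 2)
      rwa [Nat.cast_pow] at this)
  have hB := ae_tendsto_div_sq_of_integral_sq_le (μ := μ)
    -- The block k = 0 is dropped, as a bound of the form C k² would force it to vanish; from k = 1
    -- on, 2k + 1 ≤ 3k gives the factor 9.
    (Z := fun k ω => if k = 0 then 0 else R k ω) (C := 9 * C)
    (fun k => by
      rcases eq_or_ne k 0 with rfl | hk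
      · simp
      · simpa only [hk, if_false] using hRint k) (fun k => by
      rcases eq_or_ne k 0 with rfl | hk
      · simp
      have hk1 : (1 : ℝ) ≤ k := by exact_mod_cast Nat.one_le_iff_ne_zero.2 hk
      simp only [hk, if_false]
      calc ∫ ω, R k ω ^ 2 ∂μ
          ≤ ∫ ω, (2 * k + 1 : ℝ) * ∑ s ∈ Finset.Ico (k ^ 2) ((k + 1) ^ 2), z s ω ^ 2 ∂μ :=
            integral_mono (hRint k) (hBint k) (hRle k)
        _ = (2 * k + 1 : ℝ) * ∑ s ∈ Finset.Ico (k ^ 2) ((k + 1) ^ 2), ∫ ω, z s ω ^ 2 ∂μ := by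
            rw [integral_const_mul, integral_finsetSum _ fun s _ => hz s]
        _ ≤ (2 * k + 1 : ℝ) * ∑ s ∈ Finset.Ico (k ^ 2) ((k + 1) ^ 2), C := by
            gcongr with s
            exact hzC s
        _ = (2 * k + 1 : ℝ) ^ 2 * C := by
            have hc : ((k + 1) ^ 2 - k ^ 2 : ℕ) = 2 * k + 1 := by
              have : (k + 1) ^ 2 = k ^ 2 + (2 * k + 1) := by ring
              omega
            simp [hc]
            ring
        _ ≤ (3 * k : ℝ) ^ 2 * C := by
            gcongr
            linarith
        _ = 9 * C * (k : ℝ) ^ 2 := by ring)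
  filter_upwards [hA, hB] with ω hAω hBω
  have hsqrt : Tendsto Nat.sqrt atTop atTop :=
    tendsto_atTop_atTop.2 fun b => ⟨b * b, fun a ha => Nat.le_sqrt.2 ha⟩
  have hlim := (hAω.abs.add hBω).comp hsqrt
  simp only [abs_zero, add_zero] at hlim
  refine squeeze_zero_norm' ?_ hlim
  filter_upwards [eventually_ge_atTop 1] with n hn
  have hk : n.sqrt ≠ 0 := by
    have := Nat.sqrt_pos.2 hn
    omega
  have hk0 : (0 : ℝ) < n.sqrt := by exact_mod_cast Nat.pos_of_ne_zero hk
  have hle : n.sqrt ^ 2 ≤ n := Nat.sqrt_le' n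
  have hlt : n < (n.sqrt + 1) ^ 2 := Nat.lt_succ_sqrt' n
  have hleR : (n.sqrt : ℝ) ^ 2 ≤ n := by exact_mod_cast hle
  have hsplit : |∑ s ∈ Finset.range n, z s ω| ≤
      |∑ s ∈ Finset.range (n.sqrt ^ 2), z s ω| + R n.sqrt ω := by
    rw [← Finset.sum_range_add_sum_Ico _ hle]
    refine (abs_add_le _ _).trans (add_le_add le_rfl ((Finset.abs_sum_le_sum_abs _ _).trans ?_))
    exact Finset.sum_le_sum_of_subset_of_nonneg (Finset.Ico_subset_Ico le_rfl hlt.le)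
      fun _ _ _ => abs_nonneg _
  simp only [Function.comp, hk, if_false]
  rw [Real.norm_eq_abs, abs_div, Nat.abs_cast, abs_div, abs_of_nonneg (sq_nonneg (n.sqrt : ℝ)),
    ← add_div]
  exact (div_le_div_of_nonneg_left (abs_nonneg _) (by positivity) hleR).trans
    (div_le_div_of_nonneg_right hsplit (sq_nonneg _))

end SecondMoments

/-! ### Strong law for martingale differences. -/

section MartingaleLaw

variable {E Ω : Type*} [Fintype E] [Nonempty E] [MeasurableSpace E] [MeasurableSingletonClass E]
  [MeasurableSpace Ω] {μ : Measure Ω} [IsProbabilityMeasure μ] {θ : ℕ → Ω → E}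

/-- Strong law of large numbers for functions of a uniform draw and of the past. -/
theorem ae_tendsto_average_sub_mean (hθ : ∀ k, Measurable (θ k)) (hind : iIndepFun θ μ)
    (hunif : ∀ (k : ℕ) (e : E), μ.real {ω | θ k ω = e} = 1 / (Fintype.card E : ℝ))
    {H : ℕ → E → (ℕ → E) → ℝ} (hH : ∀ k e, DependsOn (H k e) (Set.Iio k)) {C : ℝ}
    (hC : ∀ k e, ∫ ω, H k e (fun l => θ l ω) ^ 2 ∂μ ≤ C) :
    ∀ᵐ ω ∂μ, Tendsto (fun n : ℕ => (∑ s ∈ Finset.range n, (H s (θ s ω) (fun l => θ l ω) -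
      (∑ e, H s e fun l => θ l ω) / (Fintype.card E : ℝ))) / (n : ℝ)) atTop (𝓝 0) := by
  have hm : (Fintype.card E : ℝ) ≠ 0 := by exact_mod_cast Fintype.card_ne_zero
  set D : ℕ → (ℕ → E) → ℝ := fun k p => H k (p k) p - (∑ e, H k e p) / (Fintype.card E : ℝ)
    with hD
  have hHd : ∀ k e n, k ≤ n → ∀ ⦃p q : ℕ → E⦄, (∀ i ∈ Set.Iio n, p i = q i) → H k e p = H k e q :=
    fun k e n hkn p q hpq => hH k e fun i hi => hpq i (lt_of_lt_of_le hi hkn)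
  have hDd : ∀ k n, k < n → DependsOn (D k) (Set.Iio n) := by
    intro k n hkn p q hpq
    simp only [hD]
    rw [hpq k hkn, hHd k (q k) n hkn.le hpq]
    simp_rw [hHd k _ n hkn.le hpq]
  have hSd : ∀ n, DependsOn (fun p => ∑ s ∈ Finset.range n, D s p) (Set.Iio n) := fun n p q hpq =>
    Finset.sum_congr rfl fun s hs => hDd s n (Finset.mem_range.1 hs) hpq
  have hD2d : ∀ n, DependsOn (fun p => D n p ^ 2) (Set.Iio (n + 1)) := fun n p q hpq => by
    simp only [hDd n (n + 1) n.lt_succ_self hpq]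
  have hS2d : ∀ n, DependsOn (fun p => (∑ s ∈ Finset.range n, D s p) ^ 2) (Set.Iio n) :=
    fun n p q hpq => by simp only [hSd n hpq]
  -- A variance is at most the second moment: subtracting the mean a over the draw lowers the sum of
  -- squares by m a².
  have hvar : ∀ n, ∫ ω, D n (fun l => θ l ω) ^ 2 ∂μ ≤ C := by
    intro n
    have h := integral_uniform_step hθ hind hunif (k := n)
      (F := fun e p => (H n e p - (∑ e', H n e' p) / (Fintype.card E : ℝ)) ^ 2)
      (fun e p q hpq => by simp_rw [hHd n _ n le_rfl hpq])
    have hint : ∀ e, Integrable (fun ω => H n e (fun l => θ l ω) ^ 2) μ := fun e =>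
      DependsOn.integrable_path (k := n) (f := fun p => H n e p ^ 2)
        (fun p q hpq => by simp_rw [hHd n _ n le_rfl hpq]) hθ
    simp only [hD]
    rw [h]
    calc _ ≤ ∫ ω, (∑ e, H n e (fun l => θ l ω) ^ 2) / (Fintype.card E : ℝ) ∂μ := by
          refine integral_mono (DependsOn.integrable_path (k := n) (f := fun p =>
            (∑ e, (H n e p - (∑ e', H n e' p) / (Fintype.card E : ℝ)) ^ 2) /
              (Fintype.card E : ℝ)) (fun p q hpq => by simp_rw [hHd n _ n le_rfl hpq]) hθ)
            ((integrable_finsetSum _ fun e _ => hint e).div_const _) fun ω => ?_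
          refine div_le_div_of_nonneg_right ?_ (Nat.cast_nonneg _)
          set a := (∑ e', H n e' fun l => θ l ω) / (Fintype.card E : ℝ) with ha
          have hsum : ∑ e', H n e' (fun l => θ l ω) = a * Fintype.card E := by
            rw [ha]
            field_simp
          simp only [sub_sq, Finset.sum_add_distrib, Finset.sum_sub_distrib, ← Finset.sum_mul,
            ← Finset.mul_sum, hsum, Finset.sum_const, Finset.card_univ, nsmul_eq_mul]
          have : (0 : ℝ) ≤ Fintype.card E := Nat.cast_nonneg _
          nlinarith [mul_nonneg this (sq_nonneg a)]
      _ = (∑ e, ∫ ω, H n e (fun l => θ l ω) ^ 2 ∂μ) / (Fintype.card E : ℝ) := by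
          rw [integral_div, integral_finsetSum _ fun e _ => hint e]
      _ ≤ (∑ _e : E, C) / (Fintype.card E : ℝ) := by
          gcongr with e
          exact hC n e
      _ = C := by
          simp [hm]
  -- The past sum is fixed while the new difference averages to zero over the draw.
  have hcross : ∀ n, ∫ ω, (∑ s ∈ Finset.range n, D s fun l => θ l ω) * D n (fun l => θ l ω) ∂μ
      = 0 := by
    intro n
    have h := integral_uniform_step hθ hind hunif (k := n)
      (F := fun e p => (∑ s ∈ Finset.range n, D s p) *
        (H n e p - (∑ e', H n e' p) / (Fintype.card E : ℝ)))
      (fun e p q hpq => by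
        have := hSd n hpq
        simp only at this
        simp_rw [this, hHd n _ n le_rfl hpq])
    refine h.trans ?_
    simp_rw [← Finset.mul_sum, Finset.sum_sub_distrib, Finset.sum_const, Finset.card_univ,
      nsmul_eq_mul, mul_div_cancel₀ _ hm, sub_self]
    simp
  refine ae_tendsto_sum_div_of_integral_sq_le (C := C) (z := fun n ω => D n fun l => θ l ω)
    (fun n => (hD2d n).integrable_path hθ)
    (fun n => ((hDd n (n + 1) n.lt_succ_self).integrable_path hθ).aestronglyMeasurable)
    (fun n => (hS2d n).integrable_path hθ) hvar fun n => ?_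
  -- Orthogonality makes second moments of the partial sums additive, hence at most C n.
  induction n with
  | zero => simp
  | succ n ih =>
    have hcd : DependsOn (fun p => (∑ s ∈ Finset.range n, D s p) * D n p) (Set.Iio (n + 1)) := by
      intro p q hpq
      have h1 := hSd n (x := p) (y := q) fun i hi => hpq i (Nat.lt_succ_of_lt hi)
      simp only at h1 ⊢
      rw [h1, hDd n (n + 1) n.lt_succ_self hpq]
    have e : ∀ ω, (∑ s ∈ Finset.range (n + 1), D s fun l => θ l ω) ^ 2 =
        (∑ s ∈ Finset.range n, D s fun l => θ l ω) ^ 2 + (2 * ((∑ s ∈ Finset.range n,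
          D s fun l => θ l ω) * D n (fun l => θ l ω)) + D n (fun l => θ l ω) ^ 2) := by
      intro ω
      rw [Finset.sum_range_succ]
      ring
    have i1 := (hS2d n).integrable_path (μ := μ) hθ
    have i2 := (hcd.integrable_path (μ := μ) hθ).const_mul 2
    have i3 := (hD2d n).integrable_path (μ := μ) hθ
    have i23 : Integrable (fun ω => 2 * ((∑ s ∈ Finset.range n, D s fun l => θ l ω) *
        D n (fun l => θ l ω)) + D n (fun l => θ l ω) ^ 2) μ := i2.add i3
    simp_rw [e]
    rw [integral_add i1 i23, integral_add i2 i3, integral_const_mul, hcross]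
    push_cast
    have := hvar n
    linarith

end MartingaleLaw

/-! ### Pseudoinverse of a Gram matrix and the normal equations. -/

section GramMatrix

variable {m n : Type*} [Fintype m] [Fintype n]

theorem IsMoorePenrose.transpose {M : Matrix m n ℝ} {X : Matrix n m ℝ} (h : IsMoorePenrose M X) :
    IsMoorePenrose Mᵀ Xᵀ where
  mul_mul_left := by rw [← transpose_mul, ← transpose_mul, ← Matrix.mul_assoc, h.mul_mul_left]
  mul_mul_right := by rw [← transpose_mul, ← transpose_mul, ← Matrix.mul_assoc, h.mul_mul_right]
  symm_left := by rw [← transpose_mul, h.symm_right, h.symm_right]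
  symm_right := by rw [← transpose_mul, h.symm_left, h.symm_left]

theorem transpose_pinv_gram (M : Matrix m n ℝ) : (pinv (Mᵀ * M))ᵀ = pinv (Mᵀ * M) := by
  have h := (pinv_spec (Mᵀ * M)).transpose
  rw [transpose_mul, transpose_transpose] at h
  exact h.unique (pinv_spec _)

theorem gram_mul_pinv_comm (M : Matrix m n ℝ) :
    Mᵀ * M * pinv (Mᵀ * M) = pinv (Mᵀ * M) * (Mᵀ * M) := by
  have h := (pinv_spec (Mᵀ * M)).symm_left
  rw [transpose_mul, transpose_pinv_gram, transpose_mul, transpose_transpose] at h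
  exact h.symm

theorem mulVec_eq_zero_of_gram_mulVec {M : Matrix m n ℝ} {z : n → ℝ} (h : (Mᵀ * M) *ᵥ z = 0) :
    M *ᵥ z = 0 := by
  have : (M *ᵥ z) ⬝ᵥ (M *ᵥ z) = 0 := by
    rw [dotProduct_mulVec, vecMul_mulVec, ← dotProduct_mulVec, h, dotProduct_zero]
  exact dotProduct_self_eq_zero.1 this

/-- The columns of (MᵀM)†(MᵀM) - 1 lie in the kernel of MᵀM, which is the kernel of M. Transposing
this identity gives the normal equations. -/
theorem gram_mulVec_pinv (M : Matrix m n ℝ) (b : m → ℝ) :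
    (Mᵀ * M) *ᵥ (pinv (Mᵀ * M) *ᵥ (Mᵀ *ᵥ b)) = Mᵀ *ᵥ b := by
  classical
  have h0 : M * (pinv (Mᵀ * M) * (Mᵀ * M) - 1) = 0 := by
    ext i j
    have : (Mᵀ * M) *ᵥ ((pinv (Mᵀ * M) * (Mᵀ * M) - 1) *ᵥ Pi.single j 1) = 0 := by
      rw [mulVec_mulVec, Matrix.mul_sub, ← Matrix.mul_assoc, (pinv_spec _).mul_mul_left,
        Matrix.mul_one, sub_self, zero_mulVec]
    have := congrFun (mulVec_eq_zero_of_gram_mulVec this) i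
    rw [mulVec_mulVec] at this
    simpa only [mulVec_single_one] using! this
  have h1 := congrArg Matrix.transpose h0
  rw [transpose_mul, transpose_sub, (pinv_spec (Mᵀ * M)).symm_right, transpose_one,
    transpose_zero, Matrix.sub_mul, sub_eq_zero, Matrix.one_mul, ← gram_mul_pinv_comm] at h1
  rw [mulVec_mulVec, mulVec_mulVec, h1]

theorem sum_mulVec_sq_le (M : Matrix m n ℝ) (z : n → ℝ) :
    ∑ i, (M *ᵥ z) i ^ 2 ≤ (∑ i, ∑ j, M i j ^ 2) * ∑ j, z j ^ 2 := by
  rw [Finset.sum_mul]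
  exact Finset.sum_le_sum fun i _ => Finset.sum_mul_sq_le_sq_mul_sq _ _ _

theorem norm_toLp_sq {ι : Type*} [Fintype ι] (z : ι → ℝ) : ‖WithLp.toLp 2 z‖ ^ 2 = z ⬝ᵥ z := by
  rw [EuclideanSpace.norm_sq_eq]
  simp [dotProduct, sq]

end GramMatrix

/-! ### Incidence matrix, Poincaré inequality, least squares. -/

namespace OrientedGraph

variable {V : Type*} [LinearOrder V] {G : OrientedGraph V}

theorem Edge.src_ne_tgt (e : G.Edge) : e.src ≠ e.tgt := (G.lt_of_mem e.1 e.2).ne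

theorem incidence_apply_sq (e : G.Edge) (l : V) :
    G.incidence e l ^ 2 = if l = e.src ∨ l = e.tgt then 1 else 0 := by
  by_cases h1 : l = e.src <;> by_cases h2 : l = e.tgt <;> simp [incidence, h1, h2]

theorem incidence_apply_sq_le_one (e : G.Edge) (l : V) : G.incidence e l ^ 2 ≤ 1 := by
  rw [incidence_apply_sq]
  split_ifs <;> norm_num

theorem incidence_apply_cube (e : G.Edge) (l : V) :
    G.incidence e l ^ 3 = G.incidence e l := by
  by_cases h1 : l = e.src <;> by_cases h2 : l = e.tgt <;> (simp [incidence, h1, h2]; try norm_num)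

variable [Fintype V]

theorem incidence_mulVec (e : G.Edge) (z : V → ℝ) :
    (G.incidence *ᵥ z) e = z e.src - z e.tgt := by
  have h : ∀ l, G.incidence e l * z l =
      (if l = e.src then z l else 0) - (if l = e.tgt then z l else 0) := by
    intro l
    by_cases h1 : l = e.src
    · simp [incidence, h1, e.src_ne_tgt]
    · by_cases h2 : l = e.tgt
      · simp [incidence, h2, e.src_ne_tgt.symm]
      · simp [incidence, h1, h2]
  simp only [mulVec, dotProduct, h, Finset.sum_sub_distrib]
  simp

theorem sum_incidence_sq (e : G.Edge) : ∑ l, G.incidence e l ^ 2 = 2 := by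
  have h : ∀ l, G.incidence e l ^ 2 =
      (if l = e.src then 1 else 0) + (if l = e.tgt then 1 else 0) := by
    intro l
    rw [incidence_apply_sq]
    by_cases h1 : l = e.src
    · simp [h1, e.src_ne_tgt]
    · simp [h1]
  simp only [h, Finset.sum_add_distrib]
  norm_num

theorem incidence_mulVec_one : G.incidence *ᵥ (fun _ => 1) = 0 := by
  ext e
  simp [incidence_mulVec]

theorem WeaklyConnected.eq_of_incidence_mulVec_eq_zero (hG : G.WeaklyConnected) {z : V → ℝ}
    (hz : G.incidence *ᵥ z = 0) (u v : V) : z u = z v := by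
  have hadj : ∀ u v, (SimpleGraph.fromRel (fun i j : V => (i, j) ∈ G.edges)).Adj u v →
      z u = z v := by
    intro u v h
    rcases (SimpleGraph.fromRel_adj _ _ _).1 h with ⟨-, h | h⟩
    · have := (incidence_mulVec (G := G) ⟨(u, v), h⟩ z).symm.trans (congrFun hz _)
      exact sub_eq_zero.1 this
    · have := (incidence_mulVec (G := G) ⟨(v, u), h⟩ z).symm.trans (congrFun hz _)
      exact (sub_eq_zero.1 this).symm
  obtain ⟨w⟩ := hG.preconnected u v
  induction w with
  | nil => rfl
  | cons h _ ih => exact (hadj _ _ h).trans ih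

/-- Otherwise the indicator of l would lie in the kernel of A, hence be constant, yet it vanishes at
the source of any edge. -/
theorem WeaklyConnected.exists_incident (hG : G.WeaklyConnected) [Nonempty G.Edge] (l : V) :
    ∃ e : G.Edge, l = e.src ∨ l = e.tgt := by
  by_contra! h
  have hz : G.incidence *ᵥ (fun v => if v = l then 1 else 0) = 0 := by
    ext e
    simp [incidence_mulVec, (h e).1.symm, (h e).2.symm]
  have e : G.Edge := Classical.arbitrary _
  have := hG.eq_of_incidence_mulVec_eq_zero hz l e.src
  simp [(h e).1.symm] at this

/-- L†L is symmetric and kills constants, so it maps into zero-sum vectors. It moves z by an element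
of ker L, a constant, which the zero sums force to be 0. -/
theorem WeaklyConnected.pinv_laplacian_mulVec (hG : G.WeaklyConnected) {z : V → ℝ}
    (hz : ∑ v, z v = 0) : pinv G.laplacian *ᵥ (G.laplacian *ᵥ z) = z := by
  set P := pinv G.laplacian * G.laplacian with hP
  have hPt : Pᵀ = P := (pinv_spec G.laplacian).symm_right
  have hL1 : G.laplacian *ᵥ (fun _ => 1) = 0 := by
    rw [laplacian, ← mulVec_mulVec, incidence_mulVec_one, mulVec_zero]
  have hsum : ∑ v, (P *ᵥ z) v = 0 := by
    have : (fun _ => 1) ⬝ᵥ (P *ᵥ z) = 0 := by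
      rw [dotProduct_mulVec, ← mulVec_transpose, hPt, hP, ← mulVec_mulVec, hL1, mulVec_zero,
        zero_dotProduct]
    simpa [dotProduct] using this
  have hLz : G.laplacian *ᵥ (P *ᵥ z - z) = 0 := by
    rw [mulVec_sub, mulVec_mulVec, hP, ← Matrix.mul_assoc, (pinv_spec _).mul_mul_left, sub_self]
  have hc := hG.eq_of_incidence_mulVec_eq_zero (mulVec_eq_zero_of_gram_mulVec hLz)
  rw [mulVec_mulVec, ← hP]
  ext v
  have h0 : ∑ u, (P *ᵥ z - z) u = 0 := by
    simp [Finset.sum_sub_distrib, hsum, hz]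
  rw [Finset.sum_congr rfl fun u _ => hc u v, Finset.sum_const, Finset.card_univ, nsmul_eq_mul,
    mul_eq_zero] at h0
  have : Nonempty V := ⟨v⟩
  have := h0.resolve_left (by exact_mod_cast Fintype.card_ne_zero)
  exact sub_eq_zero.1 this

/-- The Poincaré inequality of a weakly connected graph. -/
theorem WeaklyConnected.exists_sum_sq_le (hG : G.WeaklyConnected) :
    ∃ K : ℝ, 0 < K ∧ ∀ z : V → ℝ, ∑ v, z v = 0 →
      ∑ v, z v ^ 2 ≤ K * ∑ e, (G.incidence *ᵥ z) e ^ 2 := by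
  -- B is a left inverse of A on zero-sum vectors, so its squared Frobenius norm serves as the
  -- constant; the added 1 makes it positive.
  set B := pinv G.laplacian * G.incidenceᵀ with hB
  refine ⟨(∑ i, ∑ j, B i j ^ 2) + 1, by positivity, fun z hz => ?_⟩
  have h := hG.pinv_laplacian_mulVec hz
  have : B *ᵥ (G.incidence *ᵥ z) = z := by
    rwa [mulVec_mulVec, hB, Matrix.mul_assoc, ← laplacian, ← mulVec_mulVec]
  calc ∑ v, z v ^ 2 = ∑ v, (B *ᵥ (G.incidence *ᵥ z)) v ^ 2 := by rw [this]
    _ ≤ (∑ i, ∑ j, B i j ^ 2) * ∑ e, (G.incidence *ᵥ z) e ^ 2 := sum_mulVec_sq_le _ _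
    _ ≤ _ := by
      gcongr
      linarith

variable (b : G.Edge → ℝ)

theorem incidence_transpose_mulVec_residual :
    G.incidenceᵀ *ᵥ (b - G.incidence *ᵥ G.optimalEstimate b) = 0 := by
  rw [mulVec_sub, mulVec_mulVec, optimalEstimate, laplacian, gram_mulVec_pinv, sub_self]

theorem pinv_laplacian_mulVec_optimalEstimate :
    pinv G.laplacian *ᵥ (G.laplacian *ᵥ G.optimalEstimate b) = G.optimalEstimate b := by
  rw [optimalEstimate, laplacian, gram_mulVec_pinv]

/-- x* is fixed by the symmetric matrix L†L, which annihilates ker A. -/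
theorem dotProduct_optimalEstimate_eq_zero {d : V → ℝ} (hd : G.incidence *ᵥ d = 0) :
    G.optimalEstimate b ⬝ᵥ d = 0 := by
  have hPt : (pinv G.laplacian * G.laplacian)ᵀ = pinv G.laplacian * G.laplacian :=
    (pinv_spec G.laplacian).symm_right
  have hLd : G.laplacian *ᵥ d = 0 := by rw [laplacian, ← mulVec_mulVec, hd, mulVec_zero]
  rw [← pinv_laplacian_mulVec_optimalEstimate, mulVec_mulVec, ← hPt, mulVec_transpose,
    ← dotProduct_mulVec, ← mulVec_mulVec, hLd, mulVec_zero, dotProduct_zero]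

theorem sum_optimalEstimate : ∑ v, G.optimalEstimate b v = 0 := by
  simpa [dotProduct] using dotProduct_optimalEstimate_eq_zero b (incidence_mulVec_one (G := G))

theorem norm_residual_sq (w : V → ℝ) :
    ‖WithLp.toLp 2 (G.incidence *ᵥ w - b)‖ ^ 2 =
      ‖WithLp.toLp 2 (G.incidence *ᵥ G.optimalEstimate b - b)‖ ^ 2 +
        (G.incidence *ᵥ (w - G.optimalEstimate b)) ⬝ᵥ
          (G.incidence *ᵥ (w - G.optimalEstimate b)) := by
  set d := w - G.optimalEstimate b with hd
  have hw : G.incidence *ᵥ w - b =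
      G.incidence *ᵥ d - (b - G.incidence *ᵥ G.optimalEstimate b) := by
    rw [hd, mulVec_sub]
    abel
  have hx : (G.incidence *ᵥ d) ⬝ᵥ (b - G.incidence *ᵥ G.optimalEstimate b) = 0 := by
    rw [dotProduct_comm, dotProduct_mulVec, ← mulVec_transpose,
      incidence_transpose_mulVec_residual, zero_dotProduct]
  rw [norm_toLp_sq, norm_toLp_sq, hw, ← neg_sub b (G.incidence *ᵥ G.optimalEstimate b)]
  generalize b - G.incidence *ᵥ G.optimalEstimate b = c at hx
  rw [neg_dotProduct, dotProduct_neg, neg_neg, sub_dotProduct, dotProduct_sub, dotProduct_sub, hx, dotProduct_comm c, hx]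
  ring

theorem isMinNormLeastSquares_iff (z : V → ℝ) :
    G.IsMinNormLeastSquares b z ↔ z = G.optimalEstimate b := by
  have hLS : G.IsLeastSquares b (G.optimalEstimate b) := by
    intro w
    rw [norm_residual_sq b w]
    exact le_add_of_nonneg_right (dotProduct_self_star_nonneg _)
  have hker : ∀ w, G.IsLeastSquares b w → G.incidence *ᵥ (w - G.optimalEstimate b) = 0 := by
    intro w hw
    have h := hw (G.optimalEstimate b)
    rw [norm_residual_sq b w] at h
    refine dotProduct_self_eq_zero.1 (le_antisymm (by linarith) (dotProduct_self_star_nonneg _))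
  have hnorm : ∀ w, G.IsLeastSquares b w → ‖WithLp.toLp 2 w‖ ^ 2 =
      ‖WithLp.toLp 2 (G.optimalEstimate b)‖ ^ 2 +
        (w - G.optimalEstimate b) ⬝ᵥ (w - G.optimalEstimate b) := by
    intro w hw
    have h := dotProduct_optimalEstimate_eq_zero b (hker w hw)
    have hw' : w = G.optimalEstimate b + (w - G.optimalEstimate b) := by abel
    rw [norm_toLp_sq, norm_toLp_sq]
    generalize w - G.optimalEstimate b = d at *
    rw [hw', add_dotProduct, dotProduct_add, dotProduct_add, h, dotProduct_comm d, h]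
    ring
  constructor
  · rintro ⟨h1, h2⟩
    have h3 := hnorm z h1
    have h4 := pow_le_pow_left₀ (norm_nonneg _) (h2 _ hLS) 2
    have : (z - G.optimalEstimate b) ⬝ᵥ (z - G.optimalEstimate b) = 0 :=
      le_antisymm (by linarith) (dotProduct_self_star_nonneg _)
    exact sub_eq_zero.1 (dotProduct_self_eq_zero.1 this)
  · rintro rfl
    refine ⟨hLS, fun w hw => le_of_sq_le_sq ?_ (norm_nonneg _)⟩
    rw [hnorm w hw]
    exact le_add_of_nonneg_right (dotProduct_self_star_nonneg _)

end OrientedGraph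

/-! ### The algorithm as a recursion for the error. -/

namespace OrientedGraph

variable {V : Type*} [LinearOrder V] {G : OrientedGraph V}

section Paths

variable (γ : ℝ) (b : G.Edge → ℝ)

theorem dependsOn_gossip (k : ℕ) : DependsOn (fun p => gossip γ b p k) (Set.Iio k) := by
  induction k with
  | zero => intro p q _; rfl
  | succ k ih =>
    intro p q h
    have := ih (x := p) (y := q) fun i hi => h i (Nat.lt_succ_of_lt hi)
    simp only at this
    simp only [gossip, this, h k (Nat.lt_succ_self k)]

theorem gossip_clock_eq (p : ℕ → G.Edge) (k : ℕ) (l : V) :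
    ((gossip γ b p k).clock l : ℝ) = ∑ s ∈ Finset.range k, G.incidence (p s) l ^ 2 := by
  induction k with
  | zero => simp [gossip]
  | succ k ih =>
    rw [Finset.sum_range_succ, ← ih, incidence_apply_sq]
    by_cases h : l = (p k).src ∨ l = (p k).tgt <;> simp [gossip, gossipStep, gossipClock, h]

/-- The local time-average is the average of the raw estimates over the activation times. -/
theorem gossip_clock_mul_avg (p : ℕ → G.Edge) (k : ℕ) (l : V) :
    ((gossip γ b p k).clock l : ℝ) * (gossip γ b p k).avg l =
      ∑ s ∈ Finset.range k, G.incidence (p s) l ^ 2 * (gossip γ b p (s + 1)).raw l := by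
  induction k with
  | zero => simp [gossip]
  | succ k ih =>
    rw [Finset.sum_range_succ, ← ih, incidence_apply_sq]
    by_cases h : l = (p k).src ∨ l = (p k).tgt
    · have hne : ((gossip γ b p k).clock l : ℝ) + 1 ≠ 0 := by positivity
      simp only [gossip, gossipStep, gossipClock, h, if_true]
      push_cast
      field_simp
    · simp [gossip, gossipStep, gossipClock, h]

end Paths

variable [Fintype V]

/-- The residual `b - A L† Aᵀ b` of the least-squares problem. -/
noncomputable def residual (b : G.Edge → ℝ) : G.Edge → ℝ := b - G.incidence *ᵥ G.optimalEstimate b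

/-- The increment of the raw estimate of `l` when the edge `e` is selected and the deviation of the
raw estimates from the optimal one is `z`. -/
noncomputable def rawIncrement (γ : ℝ) (b : G.Edge → ℝ) (l : V) (z : V → ℝ) (e : G.Edge) : ℝ :=
  -γ * ((G.incidence *ᵥ z) e - residual b e) * G.incidence e l

/-- The deviation of the raw estimates from the optimal estimate. -/
noncomputable def rawError (γ : ℝ) (b : G.Edge → ℝ) (p : ℕ → G.Edge) (k : ℕ) : V → ℝ :=
  (gossip γ b p k).raw - G.optimalEstimate b

variable (γ : ℝ) (b : G.Edge → ℝ)

theorem gossipRaw_apply (e : G.Edge) (x : V → ℝ) (l : V) :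
    gossipRaw γ b e x l = x l + -γ * ((G.incidence *ᵥ x) e - b e) * G.incidence e l := by
  rw [incidence_mulVec]
  unfold gossipRaw
  by_cases h1 : l = e.src
  · simp [incidence, h1]
    ring
  · by_cases h2 : l = e.tgt
    · simp [incidence, h2, e.src_ne_tgt.symm]
      ring
    · simp [incidence, h1, h2]

theorem rawError_zero (p : ℕ → G.Edge) : rawError γ b p 0 = -G.optimalEstimate b := by
  ext l
  simp [rawError, gossip]

theorem rawError_succ (p : ℕ → G.Edge) (k : ℕ) (l : V) :
    rawError γ b p (k + 1) l = rawError γ b p k l + rawIncrement γ b l (rawError γ b p k) (p k) := by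
  simp only [rawError, gossip, gossipStep, rawIncrement, residual, Pi.sub_apply, gossipRaw_apply,
    mulVec_sub]
  ring

theorem sum_incidence (e : G.Edge) : ∑ l, G.incidence e l = 0 := by
  simpa [mulVec, dotProduct] using congrFun (incidence_mulVec_one (G := G)) e

theorem sum_rawError (p : ℕ → G.Edge) (k : ℕ) : ∑ l, rawError γ b p k l = 0 := by
  induction k with
  | zero => simp [rawError_zero, sum_optimalEstimate]
  | succ k ih =>
    simp_rw [rawError_succ, rawIncrement, Finset.sum_add_distrib, ← Finset.mul_sum, ih,
      sum_incidence]
    simp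

theorem dependsOn_rawError (k : ℕ) : DependsOn (fun p => rawError γ b p k) (Set.Iio k) := by
  intro p q h
  have := dependsOn_gossip γ b k h
  simp only at this
  simp only [rawError, this]

theorem gossip_clock_mul_avg_sub (p : ℕ → G.Edge) (k : ℕ) (l : V) :
    ((gossip γ b p k).clock l : ℝ) * ((gossip γ b p k).avg l - G.optimalEstimate b l) =
      ∑ s ∈ Finset.range k, G.incidence (p s) l ^ 2 * rawError γ b p (s + 1) l := by
  rw [mul_sub, gossip_clock_mul_avg, gossip_clock_eq, Finset.sum_mul, ← Finset.sum_sub_distrib]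
  exact Finset.sum_congr rfl fun s _ => by simp only [rawError, Pi.sub_apply]; ring

/-- The residual contributes nothing because Aᵀr = 0; this is what makes the drift vanish exactly at
x*. -/
theorem sum_rawIncrement (z : V → ℝ) (l : V) :
    ∑ e, rawIncrement γ b l z e = -γ * (G.laplacian *ᵥ z) l := by
  have h : (G.incidenceᵀ *ᵥ (G.incidence *ᵥ z - residual b)) l = (G.laplacian *ᵥ z) l := by
    rw [mulVec_sub, residual, incidence_transpose_mulVec_residual, mulVec_mulVec, laplacian,
      sub_zero]
  rw [← h]
  simp only [rawIncrement, mulVec, dotProduct, transpose_apply, Pi.sub_apply, Finset.mul_sum]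
  exact Finset.sum_congr rfl fun e _ => by ring

theorem sum_add_rawIncrement_sq (z : V → ℝ) (e : G.Edge) :
    ∑ l, (z l + rawIncrement γ b l z e) ^ 2 = ∑ l, z l ^ 2 +
      (-(2 * γ * (1 - γ)) * (G.incidence *ᵥ z) e ^ 2 + 2 * γ ^ 2 * residual b e ^ 2 +
        (2 * γ - 4 * γ ^ 2) * ((G.incidence *ᵥ z) e * residual b e)) := by
  have h : ∀ l, (z l + rawIncrement γ b l z e) ^ 2 = z l ^ 2 +
      (-2 * γ * ((G.incidence *ᵥ z) e - residual b e) * (G.incidence e l * z l) +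
      (γ * ((G.incidence *ᵥ z) e - residual b e)) ^ 2 * G.incidence e l ^ 2) := fun l => by
    rw [rawIncrement]
    ring
  have h2 : ∑ l, G.incidence e l * z l = (G.incidence *ᵥ z) e := rfl
  simp_rw [h, Finset.sum_add_distrib, ← Finset.mul_sum, sum_incidence_sq, h2]
  ring

theorem sum_incidence_mulVec_mul_residual (z : V → ℝ) :
    ∑ e, (G.incidence *ᵥ z) e * residual b e = 0 := by
  have : (G.incidence *ᵥ z) ⬝ᵥ residual b = 0 := by
    rw [dotProduct_comm, dotProduct_mulVec, ← mulVec_transpose, residual,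
      incidence_transpose_mulVec_residual, zero_dotProduct]
  exact this

/-- Summed over the edges, the cross terms between Az and r cancel by orthogonality. What remains is
dissipation, bounded below by Poincaré, and a constant noise term. -/
theorem WeaklyConnected.exists_mean_energy_le (hG : G.WeaklyConnected) [Nonempty G.Edge]
    {γ : ℝ} (hγ : γ ∈ Set.Ioo (0 : ℝ) 1) :
    ∃ β D : ℝ, 0 < β ∧ 0 ≤ D ∧ ∀ z : V → ℝ, ∑ l, z l = 0 →
      (∑ e, ∑ l, (z l + rawIncrement γ b l z e) ^ 2) / (Fintype.card G.Edge : ℝ) ≤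
        (1 - β) * ∑ l, z l ^ 2 + D := by
  obtain ⟨K, hK, hP⟩ := hG.exists_sum_sq_le
  have hm : (0 : ℝ) < Fintype.card G.Edge := by exact_mod_cast Fintype.card_pos
  have h1 : 0 < 2 * γ * (1 - γ) := mul_pos (mul_pos two_pos hγ.1) (sub_pos.2 hγ.2)
  refine ⟨2 * γ * (1 - γ) / (K * Fintype.card G.Edge),
    2 * γ ^ 2 * (∑ e, residual b e ^ 2) / Fintype.card G.Edge, by positivity,
    by positivity, fun z hz => ?_⟩
  simp_rw [sum_add_rawIncrement_sq, Finset.sum_add_distrib, ← Finset.mul_sum,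
    sum_incidence_mulVec_mul_residual, Finset.sum_const, Finset.card_univ, nsmul_eq_mul]
  have h2 := mul_le_mul_of_nonneg_left ((div_le_iff₀' hK).2 (hP z hz)) h1.le
  have h3 : (1 - 2 * γ * (1 - γ) / (K * Fintype.card G.Edge)) * ∑ l, z l ^ 2 +
      2 * γ ^ 2 * (∑ e, residual b e ^ 2) / Fintype.card G.Edge =
      (Fintype.card G.Edge * ∑ l, z l ^ 2 - 2 * γ * (1 - γ) * ((∑ l, z l ^ 2) / K) +
        2 * γ ^ 2 * ∑ e, residual b e ^ 2) / Fintype.card G.Edge := by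
    field_simp
  rw [h3]
  refine div_le_div_of_nonneg_right ?_ hm.le
  linarith

/-! ### Mean-square bounds and laws of large numbers for the error. -/

section RandomEdges

variable {γ : ℝ} {Ω : Type*} [MeasurableSpace Ω] {μ : Measure Ω} [IsProbabilityMeasure μ]
  {θ : ℕ → Ω → G.Edge}

instance : MeasurableSingletonClass G.Edge := ⟨fun _ => trivial⟩

variable (μ θ) in
theorem integrable_rawError_energy [Nonempty G.Edge] (hθ : ∀ k, Measurable (θ k)) (k : ℕ) :
    Integrable (fun ω => ∑ l, rawError γ b (fun i => θ i ω) k l ^ 2) μ :=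
  DependsOn.integrable_path (k := k) (f := fun p => ∑ l, rawError γ b p k l ^ 2)
    (fun p q h => by
      have := dependsOn_rawError γ b k h
      simp only at this
      simp only [this]) hθ

/-- The raw estimates are bounded in mean square. -/
theorem WeaklyConnected.exists_integral_energy_le [Nonempty G.Edge] (hG : G.WeaklyConnected)
    (hγ : γ ∈ Set.Ioo (0 : ℝ) 1) (hθ : ∀ k, Measurable (θ k)) (hind : iIndepFun θ μ)
    (hunif : ∀ (k : ℕ) (e : G.Edge),
      μ.real {ω | θ k ω = e} = 1 / (Fintype.card G.Edge : ℝ)) :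
    ∃ C : ℝ, ∀ k, ∫ ω, ∑ l, rawError γ b (fun i => θ i ω) k l ^ 2 ∂μ ≤ C := by
  obtain ⟨β, D, hβ, hD, hstep⟩ := hG.exists_mean_energy_le b hγ
  set W : ℕ → ℝ := fun k => ∫ ω, ∑ l, rawError γ b (fun i => θ i ω) k l ^ 2 ∂μ with hW
  have hW0 : ∀ k, 0 ≤ W k := fun k =>
    integral_nonneg fun ω => Finset.sum_nonneg fun l _ => sq_nonneg _
  have hrec : ∀ k, W (k + 1) ≤ (1 - β) * W k + D := by
    intro k
    have hdep : ∀ e : G.Edge, DependsOn (fun p : ℕ → G.Edge => ∑ l, (rawError γ b p k l +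
        rawIncrement γ b l (rawError γ b p k) e) ^ 2) (Set.Iio k) := by
      intro e p q h
      have := dependsOn_rawError γ b k h
      simp only at this
      simp only [this]
    have h := integral_uniform_step hθ hind hunif hdep
    simp only [hW, rawError_succ]
    rw [h]
    have hint := integrable_rawError_energy (γ := γ) b μ θ hθ k
    calc _ ≤ ∫ ω, ((1 - β) * ∑ l, rawError γ b (fun i => θ i ω) k l ^ 2 + D) ∂μ := by
          refine integral_mono ((integrable_finsetSum _ fun e _ =>
            (hdep e).integrable_path hθ).div_const _)
            ((hint.const_mul _).add (integrable_const _)) fun ω => ?_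
          exact hstep _ (sum_rawError γ b _ k)
      _ = _ := by
          rw [integral_add (hint.const_mul _) (integrable_const _), integral_const_mul]
          simp
  -- D/β is the fixed point of the recursion. The extra D covers β ≥ 1, where the coefficient 1 - β
  -- is nonpositive and each later term is at most D.
  refine ⟨W 0 + D / β + D, fun k => ?_⟩
  have hDβ : β * (D / β) = D := by field_simp
  have hDβ0 : 0 ≤ D / β := div_nonneg hD hβ.le
  induction k with
  | zero => exact le_add_of_le_of_nonneg (le_add_of_nonneg_right hDβ0) hD
  | succ k ih =>
    refine (hrec k).trans ?_
    rcases le_total β 1 with h | h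
    · have h1 := mul_le_mul_of_nonneg_left ih (sub_nonneg.2 h)
      have h2 := mul_nonneg hβ.le (hW0 0)
      have h3 := mul_nonneg hβ.le hD
      simp only [hW] at *
      nlinarith
    · have h1 := mul_nonneg (sub_nonneg.2 h) (hW0 k)
      have h2 := hW0 0
      simp only [hW] at *
      nlinarith

/-- Strong law of large numbers for the martingale differences that are controlled by the energy of
the raw estimates. -/
theorem ae_tendsto_average_of_sq_le_energy [Nonempty G.Edge]
    (hθ : ∀ k, Measurable (θ k)) (hind : iIndepFun θ μ)
    (hunif : ∀ (k : ℕ) (e : G.Edge),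
      μ.real {ω | θ k ω = e} = 1 / (Fintype.card G.Edge : ℝ))
    {C : ℝ} (hC : ∀ k, ∫ ω, ∑ l, rawError γ b (fun i => θ i ω) k l ^ 2 ∂μ ≤ C)
    (h : G.Edge → (V → ℝ) → ℝ) {c₁ c₂ : ℝ} (hc : 0 ≤ c₁)
    (hh : ∀ e z, h e z ^ 2 ≤ c₁ * ∑ l, z l ^ 2 + c₂) :
    ∀ᵐ ω ∂μ, Tendsto (fun n : ℕ => (∑ s ∈ Finset.range n,
      (h (θ s ω) (rawError γ b (fun i => θ i ω) s) -
        (∑ e, h e (rawError γ b (fun i => θ i ω) s)) / (Fintype.card G.Edge : ℝ))) / (n : ℝ))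
      atTop (𝓝 0) := by
  have hdep : ∀ k e, DependsOn (fun p => h e (rawError γ b p k)) (Set.Iio k) := by
    intro k e p q hpq
    have := dependsOn_rawError γ b k hpq
    simp only at this
    simp only [this]
  refine ae_tendsto_average_sub_mean hθ hind hunif (H := fun k e p => h e (rawError γ b p k))
    hdep (C := c₁ * C + c₂) fun k e => ?_
  have hint := integrable_rawError_energy (γ := γ) b μ θ hθ k
  calc ∫ ω, h e (rawError γ b (fun l => θ l ω) k) ^ 2 ∂μ
      ≤ ∫ ω, (c₁ * ∑ l, rawError γ b (fun i => θ i ω) k l ^ 2 + c₂) ∂μ := by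
        refine integral_mono (DependsOn.integrable_path (k := k)
          (f := fun p => h e (rawError γ b p k) ^ 2) (fun p q hpq => ?_) hθ)
          ((hint.const_mul _).add (integrable_const _)) fun ω => hh _ _
        have := hdep k e hpq
        simp only at this
        simp only [this]
    _ = c₁ * (∫ ω, ∑ l, rawError γ b (fun i => θ i ω) k l ^ 2 ∂μ) + c₂ := by
        rw [integral_add (hint.const_mul _) (integrable_const _), integral_const_mul]
        simp
    _ ≤ c₁ * C + c₂ := by
        gcongr
        exact hC k

theorem ae_tendsto_rawError_div [Nonempty G.Edge] (hθ : ∀ k, Measurable (θ k))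
    {C : ℝ} (hC : ∀ k, ∫ ω, ∑ l, rawError γ b (fun i => θ i ω) k l ^ 2 ∂μ ≤ C) (l : V) :
    ∀ᵐ ω ∂μ, Tendsto (fun n : ℕ => rawError γ b (fun i => θ i ω) n l / (n : ℝ)) atTop (𝓝 0) := by
  have hint : ∀ k, Integrable (fun ω => rawError γ b (fun i => θ i ω) k l ^ 2) μ := fun k =>
    DependsOn.integrable_path (k := k) (f := fun p => rawError γ b p k l ^ 2) (fun p q h => by
      have := dependsOn_rawError γ b k h
      simp only at this
      simp only [this]) hθ
  refine ae_tendsto_div_of_integral_sq_le hint fun k => le_trans ?_ (hC k)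
  exact integral_mono (hint k) (integrable_rawError_energy b μ θ hθ k) fun ω =>
    Finset.single_le_sum (f := fun l => rawError γ b (fun i => θ i ω) k l ^ 2)
      (fun _ _ => sq_nonneg _) (Finset.mem_univ l)

end RandomEdges

/-! ### Pathwise convergence of the time-averages. -/

theorem rawIncrement_sq_le (l : V) (z : V → ℝ) (e : G.Edge) :
    rawIncrement γ b l z e ^ 2 ≤ 2 * γ ^ 2 * (∑ i, ∑ j, G.incidence i j ^ 2) * ∑ v, z v ^ 2 +
      2 * γ ^ 2 * ∑ i, residual b i ^ 2 := by
  have h1 : (G.incidence *ᵥ z) e ^ 2 ≤ (∑ i, ∑ j, G.incidence i j ^ 2) * ∑ v, z v ^ 2 :=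
    (Finset.single_le_sum (f := fun i => (G.incidence *ᵥ z) i ^ 2) (fun _ _ => sq_nonneg _)
      (Finset.mem_univ e)).trans (sum_mulVec_sq_le _ _)
  have h2 : residual b e ^ 2 ≤ ∑ i, residual b i ^ 2 :=
    Finset.single_le_sum (f := fun i => residual b i ^ 2) (fun _ _ => sq_nonneg _)
      (Finset.mem_univ e)
  have h3 : ((G.incidence *ᵥ z) e - residual b e) ^ 2 ≤
      2 * ((G.incidence *ᵥ z) e ^ 2 + residual b e ^ 2) := by
    nlinarith [sq_nonneg ((G.incidence *ᵥ z) e + residual b e)]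
  calc rawIncrement γ b l z e ^ 2
      = γ ^ 2 * ((G.incidence *ᵥ z) e - residual b e) ^ 2 * G.incidence e l ^ 2 := by
        rw [rawIncrement]
        ring
    _ ≤ γ ^ 2 * (2 * ((∑ i, ∑ j, G.incidence i j ^ 2) * ∑ v, z v ^ 2 +
          ∑ i, residual b i ^ 2)) * 1 := by
        gcongr
        · exact h3.trans (by linarith)
        · exact incidence_apply_sq_le_one e l
    _ = _ := by ring

/-- The increments of the time-average, weighted by the activation indicator. -/
theorem activation_mul_add_rawIncrement (l : V) (z : V → ℝ) (e : G.Edge) :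
    G.incidence e l ^ 2 * (z l + rawIncrement γ b l z e) =
      G.incidence e l ^ 2 * z l + rawIncrement γ b l z e := by
  have := incidence_apply_cube e l
  rw [rawIncrement]
  linear_combination (-γ * ((G.incidence *ᵥ z) e - residual b e)) * this

/-- Convergence of the time-averages along a path that satisfies the laws of large numbers for the
clocks, for the increments of the raw estimates, and for their values at activation times. -/
theorem tendsto_avg_of_averages (hG : G.WeaklyConnected) [Nonempty G.Edge] {γ : ℝ} (hγ : γ ≠ 0)
    (p : ℕ → G.Edge)
    (hy : ∀ l, Tendsto (fun n : ℕ => rawError γ b p n l / (n : ℝ)) atTop (𝓝 0))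
    (hclock : ∀ l, Tendsto (fun n : ℕ => (∑ s ∈ Finset.range n, (G.incidence (p s) l ^ 2 -
      (∑ e, G.incidence e l ^ 2) / (Fintype.card G.Edge : ℝ))) / (n : ℝ)) atTop (𝓝 0))
    (hinc : ∀ l, Tendsto (fun n : ℕ => (∑ s ∈ Finset.range n,
      (rawIncrement γ b l (rawError γ b p s) (p s) -
        (∑ e, rawIncrement γ b l (rawError γ b p s) e) / (Fintype.card G.Edge : ℝ))) / (n : ℝ))
      atTop (𝓝 0))
    (hact : ∀ l, Tendsto (fun n : ℕ => (∑ s ∈ Finset.range n,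
      (G.incidence (p s) l ^ 2 * (rawError γ b p s l +
        rawIncrement γ b l (rawError γ b p s) (p s)) -
        (∑ e, G.incidence e l ^ 2 * (rawError γ b p s l +
          rawIncrement γ b l (rawError γ b p s) e)) / (Fintype.card G.Edge : ℝ))) / (n : ℝ))
      atTop (𝓝 0)) :
    Tendsto (fun k => (gossip γ b p k).avg) atTop (𝓝 (G.optimalEstimate b)) := by
  have hm : (0 : ℝ) < Fintype.card G.Edge := by exact_mod_cast Fintype.card_pos
  set y := rawError γ b p with hydef
  have hLsum : ∀ n l, ∑ s ∈ Finset.range n, (G.laplacian *ᵥ y s) l =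
      (G.laplacian *ᵥ ∑ s ∈ Finset.range n, y s) l := by
    intro n l
    rw [mulVec_sum, Finset.sum_apply]
  -- The increments telescope to o(n), so the sum of their means, -(γ/m) L Σ y(s), is o(n) as well.
  have hT : ∀ l, Tendsto (fun n : ℕ => (G.laplacian *ᵥ ∑ s ∈ Finset.range n, y s) l / (n : ℝ))
      atTop (𝓝 0) := by
    intro l
    have h0 : Tendsto (fun n : ℕ => y 0 l / (n : ℝ)) atTop (𝓝 0) :=
      tendsto_const_div_atTop_nhds_zero_nat _
    have h := ((hinc l).sub ((hy l).sub h0)).const_mul ((Fintype.card G.Edge : ℝ) / γ)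
    simp only [sub_zero, mul_zero] at h
    refine h.congr fun n => ?_
    have htel : ∑ s ∈ Finset.range n, rawIncrement γ b l (y s) (p s) = y n l - y 0 l := by
      rw [← Finset.sum_range_sub (fun k => y k l)]
      refine Finset.sum_congr rfl fun s _ => ?_
      rw [hydef, rawError_succ]
      ring
    simp_rw [Finset.sum_sub_distrib, sum_rawIncrement, ← Finset.sum_div, ← Finset.mul_sum, hLsum,
      htel]
    field_simp
    ring
  -- Applying L† recovers the zero-sum vector Σ y(s) from its image under L.
  have hY : ∀ l, Tendsto (fun n : ℕ => (∑ s ∈ Finset.range n, y s l) / (n : ℝ)) atTop (𝓝 0) := by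
    intro l
    have h := tendsto_finsetSum Finset.univ fun (j : V) _ =>
      (hT j).const_mul (pinv G.laplacian l j)
    simp only [mul_zero, Finset.sum_const_zero] at h
    refine h.congr fun n => ?_
    have hz : ∑ v, (∑ s ∈ Finset.range n, y s) v = 0 := by
      simp_rw [Finset.sum_apply]
      rw [Finset.sum_comm]
      exact Finset.sum_eq_zero fun s _ => sum_rawError γ b p s
    have := congrFun (hG.pinv_laplacian_mulVec hz) l
    rw [← Finset.sum_apply, ← this]
    simp only [← mul_div_assoc, ← Finset.sum_div]
    rfl
  rw [tendsto_pi_nhds]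
  intro l
  set d := ∑ e, G.incidence e l ^ 2 with hd
  have hdpos : 0 < d := by
    obtain ⟨e, he⟩ := hG.exists_incident l
    refine Finset.sum_pos' (fun _ _ => sq_nonneg _) ⟨e, Finset.mem_univ e, ?_⟩
    rw [incidence_apply_sq, if_pos he]
    exact one_pos
  have hκ : Tendsto (fun n : ℕ => ((gossip γ b p n).clock l : ℝ) / (n : ℝ)) atTop
      (𝓝 (d / Fintype.card G.Edge)) := by
    have h := (hclock l).add_const (d / Fintype.card G.Edge)
    rw [zero_add] at h
    refine h.congr' ?_
    filter_upwards [eventually_ge_atTop 1] with n hn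
    have hn0 : (n : ℝ) ≠ 0 := by exact_mod_cast (by omega : n ≠ 0)
    rw [Finset.sum_sub_distrib, ← gossip_clock_eq γ b, Finset.sum_const, Finset.card_range,
      nsmul_eq_mul, ← hd]
    field_simp
    ring
  have hN : Tendsto (fun n : ℕ => ((gossip γ b p n).clock l : ℝ) *
      ((gossip γ b p n).avg l - G.optimalEstimate b l) / (n : ℝ)) atTop (𝓝 0) := by
    -- The mean of the activated error over the draw is (d/m) y_l - (γ/m)(Ly)_l; both time-averages
    -- vanish by `hY` and `hT`.
    have h := (hact l).add (((hY l).const_mul (d / Fintype.card G.Edge)).sub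
      ((hT l).const_mul (γ / Fintype.card G.Edge)))
    simp only [mul_zero, sub_zero, add_zero] at h
    refine h.congr fun n => ?_
    rw [gossip_clock_mul_avg_sub]
    simp_rw [rawError_succ, activation_mul_add_rawIncrement, Finset.sum_add_distrib,
      sum_rawIncrement, ← Finset.sum_mul, ← hd, Finset.sum_sub_distrib, ← Finset.sum_div,
      Finset.sum_add_distrib, ← Finset.mul_sum, hLsum, ← hydef]
    ring
  have hlim := hN.div hκ (div_pos hdpos hm).ne'
  rw [zero_div] at hlim
  rw [← tendsto_sub_nhds_zero_iff]
  refine hlim.congr' ?_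
  -- The positive limit of clock/n makes the clock eventually nonzero, so it can be cancelled.
  filter_upwards [hκ.eventually_ne (div_pos hdpos hm).ne'] with n hn
  have h1 : ((gossip γ b p n).clock l : ℝ) ≠ 0 := fun h => hn (by rw [h, zero_div])
  have h2 : (n : ℝ) ≠ 0 := fun h => hn (by rw [h, div_zero])
  simp only [Pi.div_apply]
  field_simp

end OrientedGraph

theorem theorem2 {V : Type*} [Fintype V] [LinearOrder V]
    (G : OrientedGraph V) (hG : G.WeaklyConnected)
    (b : G.Edge → ℝ) (γ : ℝ) (hγ : γ ∈ Set.Ioo (0 : ℝ) 1)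
    {Ω : Type*} [MeasurableSpace Ω] (μ : Measure Ω) [IsProbabilityMeasure μ]
    (θ : ℕ → Ω → G.Edge) (hmeas : ∀ k, Measurable (θ k))
    (hindep : iIndepFun θ μ)
    (hunif : ∀ (k : ℕ) (e : G.Edge),
      μ.real {ω | θ k ω = e} = 1 / (Fintype.card G.Edge : ℝ)) :
    (∀ z : V → ℝ, G.IsMinNormLeastSquares b z ↔ z = G.optimalEstimate b) ∧
    ∀ᵐ ω ∂μ, Tendsto (fun k => (gossip γ b (fun l => θ l ω) k).avg) atTop
      (𝓝 (G.optimalEstimate b)) := by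
  refine ⟨G.isMinNormLeastSquares_iff b, ?_⟩
  have : Nonempty Ω := nonempty_of_isProbabilityMeasure μ
  -- The existence of the draws already forces an edge, so no bound on the number of nodes is
  -- needed.
  have : Nonempty G.Edge := ⟨θ 0 (Classical.arbitrary Ω)⟩
  obtain ⟨C, hC⟩ := hG.exists_integral_energy_le b hγ hmeas hindep hunif
  have hy := ae_all_iff.2 fun l => OrientedGraph.ae_tendsto_rawError_div b hmeas hC l
  have hclock := ae_all_iff.2 fun l => OrientedGraph.ae_tendsto_average_of_sq_le_energy b hmeas
    hindep hunif hC (fun e _ => G.incidence e l ^ 2) (c₁ := 0) (c₂ := 1) le_rfl fun e z => by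
      rw [zero_mul, zero_add]
      exact pow_le_one₀ (sq_nonneg _) (OrientedGraph.incidence_apply_sq_le_one e l)
  have hinc := ae_all_iff.2 fun l => OrientedGraph.ae_tendsto_average_of_sq_le_energy b hmeas
    hindep hunif hC (fun e z => OrientedGraph.rawIncrement γ b l z e) (by positivity)
    fun e z => OrientedGraph.rawIncrement_sq_le γ b l z e
  have hact := ae_all_iff.2 fun l => OrientedGraph.ae_tendsto_average_of_sq_le_energy b hmeas
    hindep hunif hC
    (fun e z => G.incidence e l ^ 2 * (z l + OrientedGraph.rawIncrement γ b l z e))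
    -- These constants come from (u + v)² ≤ 2(u² + v²) together with the bound on the squared
    -- increment.
    (c₁ := 2 * (1 + 2 * γ ^ 2 * (∑ i, ∑ j, G.incidence i j ^ 2)))
    (c₂ := 2 * (2 * γ ^ 2 * ∑ i, OrientedGraph.residual b i ^ 2)) (by positivity) fun e z => by
      have h1 := OrientedGraph.rawIncrement_sq_le γ b l z e
      have h2 : z l ^ 2 ≤ ∑ v, z v ^ 2 :=
        Finset.single_le_sum (f := fun v => z v ^ 2) (fun _ _ => sq_nonneg _) (Finset.mem_univ l)
      have h3 : (G.incidence e l ^ 2) ^ 2 ≤ 1 :=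
        pow_le_one₀ (sq_nonneg _) (OrientedGraph.incidence_apply_sq_le_one e l)
      rw [mul_pow]
      refine (mul_le_of_le_one_left (sq_nonneg _) h3).trans (add_sq_le.trans ?_)
      linarith
  filter_upwards [hy, hclock, hinc, hact] with ω h1 h2 h3 h4
  exact OrientedGraph.tendsto_avg_of_averages b hG hγ.1.ne' _ h1 h2 h3 h4
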